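/- Let $d \in \mathbb{N} \cup \{\infty\}$ and let $\mathbb{B}_d$ be the open unit ball of $\mathbb{C}^d$ (understood as $\ell^2$ if $d = \infty$), with $\langle z, w \rangle = \sum_n z_n \overline{w_n}$. Let $H^2_d$ (the Drury--Arveson space) be the reproducing kernel Hilbert space on $\mathbb{B}_d$ with kernel $K(z,w) = \frac{1}{1 - \langle z,w \rangle}$, and for $V \subset \mathbb{B}_d$ let $H^2_d|_V$ be the reproducing kernel Hilbert space on $V$ whose kernel is the restriction of $K$ to $V \times V$. For a reproducing kernel Hilbert space $\mathcal{H}$ on a set $X$, let $\operatorname{Mult}(\mathcal{H})$ be the algebra of all functions $\varphi : X \to \mathbb{C}$ such that $\varphi \cdot f \in \mathcal{H}$ for all $f \in \mathcal{H}$. **Proposition.** Let $\mathcal{H}$ be a reproducing kernel Hilbert space of complex-valued functions on a set $X$ with reproducing kernel $k$, and suppose that $\mathcal{H}$ separates the points of $X$, that is, whenever $z, w \in X$ with $z \neq w$, there exists $f \in \mathcal{H}$ with $f(z) = 0$ and $f(w) = 1$. Let $b : X \to \mathbb{B}_d$ and $\delta : X \to \mathbb{C} \setminus \{0\}$ be mappings,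 and let $V = b(X)$. Consider the following statements: - (i) $k(z,w) = \dfrac{\delta(z) \overline{\delta(w)}}{1 - \langle b(z), b(w) \rangle}$ for all $z, w \in X$; - (i') the assignment $f \mapsto \delta \cdot (f \circ b)$ defines a co-isometry $H^2_d \to \mathcal{H}$ (a bounded operator $T$ with $T T^* = I$); - (i'') the assignment $f \mapsto \delta \cdot (f \circ b)$ defines a unitary $H^2_d|_V \to \mathcal{H}$; - (ii) the assignment $f \mapsto \delta \cdot (f \circ b)$ defines a surjection $H^2_d \to \mathcal{H}$; - (ii') the assignment $f \mapsto \delta \cdot (f \circ b)$ defines a bijection $H^2_d|_V \to \mathcal{H}$; - (iii) the assignment $\varphi \mapsto \varphi \circ b$ defines a surjection $\operatorname{Mult}(H^2_d) \to \operatorname{Mult}(\mathcal{H})$; - (iii') the assignment $\varphi \mapsto \varphi \circ b$ defines a bijection $\operatorname{Mult}(H^2_d|_V) \to \operatorname{Mult}(\mathcal{H})$. Then the implications (i) $\Leftrightarrow$ (i') $\Leftrightarrow$ (i'') $\Rightarrow$ (ii) $\Leftrightarrow$ (ii') $\Rightarrow$ (iii) $\Leftrightarrow$ (iii') hold. Here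 "defines" includes the claim that the assignment maps the first space into the second. -/

import Mathlib

open scoped ComplexConjugate

noncomputable section

namespace EmbRKHS

/-- The Hilbert space `ℂ^d` for `d ∈ ℕ ∪ {∞}`: square-summable complex families indexed by the
natural numbers `n < d`. For finite `d` it is `ℂ^d` with the Euclidean norm; for `d = ∞` it is
`ℓ²`. -/
abbrev Cd (d : ℕ∞) : Type := lp (fun _ : {n : ℕ // (n : ℕ∞) < d} => ℂ) 2

/-- The open unit ball `𝔹_d` of `ℂ^d`. -/
abbrev Ball (d : ℕ∞) : Set (Cd d) := Metric.ball (0 : Cd d) 1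

/-- The pairing `⟨z, w⟩ = ∑ z_n * conj w_n`, linear in the first variable. (Mathlib's `inner` is
linear in the second variable.) -/
def pairing {d : ℕ∞} (z w : Cd d) : ℂ := inner ℂ w z

/-- The Drury--Arveson kernel `K(z, w) = 1 / (1 - ⟨z, w⟩)` on `𝔹_d`; the complex number `K(z, w)`
is regarded as the operator of multiplication by it on `ℂ`, which is Mathlib's format for
kernels. -/
def daKernel (d : ℕ∞) : Matrix (Ball d) (Ball d) (ℂ →L[ℂ] ℂ) :=
  Matrix.of fun z w => (1 / (1 - pairing (z : Cd d) (w : Cd d))) • ContinuousLinearMap.id ℂ ℂ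

theorem norm_pairing_lt_one {d : ℕ∞} (z w : Ball d) : ‖pairing (z : Cd d) (w : Cd d)‖ < 1 := by
  have hz : ‖(z : Cd d)‖ < 1 := mem_ball_zero_iff.1 z.2
  have hw : ‖(w : Cd d)‖ < 1 := mem_ball_zero_iff.1 w.2
  refine (norm_inner_le_norm (𝕜 := ℂ) (w : Cd d) (z : Cd d)).trans_lt ?_
  nlinarith [norm_nonneg (z : Cd d), norm_nonneg (w : Cd d)]

open scoped ComplexOrder in
theorem gram_pow_nonneg {𝕜 E ι : Type*} [RCLike 𝕜] [NormedAddCommGroup E]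
    [InnerProductSpace 𝕜 E] [Fintype ι] (v : ι → E) (n : ℕ) (c : ι → 𝕜) :
    0 ≤ RCLike.re (∑ i, ∑ j, star (c i) * (inner 𝕜 (v i) (v j) ^ n * c j)) := by
  have key : (Matrix.of fun i j => inner 𝕜 (v i) (v j) ^ n : Matrix ι ι 𝕜).PosSemidef := by
    induction n with
    | zero =>
      have h := Matrix.posSemidef_gram 𝕜 (fun _ : ι => (1 : 𝕜))
      convert h using 1
      ext i j
      simp
    | succ n ih =>
      have h := ih.hadamard (Matrix.posSemidef_gram 𝕜 v)
      convert h using 1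
      ext i j
      simp [pow_succ]
  have h := (RCLike.le_iff_re_im.1 (key.dotProduct_mulVec_nonneg c)).1
  simpa [dotProduct, Matrix.mulVec, Finset.mul_sum] using h

theorem daKernel_posSemidef (d : ℕ∞) : (daKernel d).PosSemidef := by
  have hH : (daKernel d).IsHermitian := by
    ext z w
    have hid : ContinuousLinearMap.adjoint (ContinuousLinearMap.id ℂ ℂ) =
        ContinuousLinearMap.id ℂ ℂ := ContinuousLinearMap.adjoint_id
    simp [daKernel, pairing, ContinuousLinearMap.star_eq_adjoint, Matrix.conjTranspose_apply, hid]
  have tfae := (RKHS.posSemidef_tfae (K := daKernel d)).out 0 2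
  rw [tfae]
  refine ⟨hH, fun vv => ?_⟩
  have hs : HasSum
      (fun n : ℕ => RCLike.re (∑ z ∈ vv.support, ∑ w ∈ vv.support,
        star (star (vv z)) * (inner ℂ (z : Cd d) (w : Cd d) ^ n * star (vv w))))
      (RCLike.re (∑ z ∈ vv.support, ∑ w ∈ vv.support,
        star (star (vv z)) * ((1 - inner ℂ (z : Cd d) (w : Cd d))⁻¹ * star (vv w)))) := by
    refine RCLike.hasSum_re ℂ (hasSum_sum fun z _ => hasSum_sum fun w _ => ?_)
    exact ((hasSum_geometric_of_norm_lt_one (norm_pairing_lt_one w z)).mul_right _).mul_left _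
  have h0 := hs.nonneg fun n => by
    have := gram_pow_nonneg (𝕜 := ℂ) (fun z : vv.support => ((z : Ball d) : Cd d)) n
      (fun z => star (vv z))
    rw [← Finset.sum_coe_sort]
    simp_rw [← Finset.sum_coe_sort vv.support]
    exact this
  rw [Finset.sum_comm] at h0
  refine h0.trans_eq (congrArg _ ?_)
  simp only [Finsupp.sum]
  refine Finset.sum_congr rfl fun z _ => Finset.sum_congr rfl fun w _ => ?_
  have hc : conj (inner ℂ (z : Cd d) (w : Cd d)) = inner ℂ (w : Cd d) (z : Cd d) :=
    inner_conj_symm _ _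
  simp [daKernel, pairing, hc]

instance fact_daKernel (d : ℕ∞) : Fact (daKernel d).PosSemidef := ⟨daKernel_posSemidef d⟩

/-- The restriction of the Drury--Arveson kernel to `V × V`, for `V ⊆ 𝔹_d`. -/
def daKernelOn {d : ℕ∞} (V : Set (Ball d)) : Matrix V V (ℂ →L[ℂ] ℂ) :=
  (daKernel d).submatrix (fun z => (z : Ball d)) (fun z => (z : Ball d))

instance fact_daKernelOn {d : ℕ∞} (V : Set (Ball d)) : Fact (daKernelOn V).PosSemidef :=
  ⟨(daKernel_posSemidef d).submatrix _⟩

/-- The Drury--Arveson space `H²_d`: the reproducing kernel Hilbert space on `𝔹_d` with kernel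
`K(z, w) = 1 / (1 - ⟨z, w⟩)`. -/
abbrev DruryArveson (d : ℕ∞) : Type := RKHS.OfKernel (daKernel d)

/-- The space `H²_d|_V`: the reproducing kernel Hilbert space on `V` whose kernel is the
restriction of the Drury--Arveson kernel to `V × V`. -/
abbrev DruryArvesonOn {d : ℕ∞} (V : Set (Ball d)) : Type := RKHS.OfKernel (daKernelOn V)

section Spaces

variable {X Y : Type*} (H : Type*) [NormedAddCommGroup H] [InnerProductSpace ℂ H] [RKHS ℂ H X ℂ]
  (G : Type*) [NormedAddCommGroup G] [InnerProductSpace ℂ G] [RKHS ℂ G Y ℂ]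

/-- The scalar reproducing kernel `k(z, w)` of `H`; thus `k(·, w) ∈ H` and
`⟨f, k(·, w)⟩ = f(w)`. -/
def scalarKernel [CompleteSpace H] (z w : X) : ℂ := RKHS.kernel H z w 1

/-- `H` separates the points of `X`. -/
def SeparatesPoints : Prop := ∀ z w : X, z ≠ w → ∃ f : H, f z = 0 ∧ f w = 1

/-- The multiplier algebra `Mult(H)`: all functions `φ : X → ℂ` with `φ · f ∈ H` for every
`f ∈ H`. -/
def Mult : Subalgebra ℂ (X → ℂ) where
  carrier := {φ | ∀ f : H, ∃ g : H, ∀ x, g x = φ x * f x}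
  mul_mem' := by
    intro φ ψ hφ hψ f
    obtain ⟨g, hg⟩ := hψ f
    obtain ⟨h, hh⟩ := hφ g
    exact ⟨h, fun x => by rw [hh, hg, Pi.mul_apply, mul_assoc]⟩
  add_mem' := by
    intro φ ψ hφ hψ f
    obtain ⟨g, hg⟩ := hψ f
    obtain ⟨h, hh⟩ := hφ f
    exact ⟨h + g, fun x => by simp [hh, hg, add_mul]⟩
  algebraMap_mem' := by
    intro c f
    exact ⟨c • f, fun x => by simp [Pi.algebraMap_apply]⟩

variable {H G}

/-- The map `T : G → H` between reproducing kernel Hilbert spaces on `Y` and `X` is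
`f ↦ δ · (f ∘ b)`. The assignment `f ↦ δ · (f ∘ b)` defines a map `G → H` if and only if
such a `T` exists, and then `T` is unique. -/
def IsWeightedComp (δ : X → ℂ) (b : X → Y) (T : G → H) : Prop :=
  ∀ (f : G) (x : X), T f x = δ x * f (b x)

/-- The map `Φ : Mult(G) → Mult(H)` is `φ ↦ φ ∘ b`. -/
def IsMultComp (b : X → Y) (Φ : Mult G → Mult H) : Prop :=
  ∀ (φ : Mult G) (x : X), (Φ φ : X → ℂ) x = (φ : Y → ℂ) (b x)

/-- A bounded operator `T` between Hilbert spaces is a co-isometry if `T T* = I`. -/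
def IsCoisometry [CompleteSpace G] [CompleteSpace H] (T : G →L[ℂ] H) : Prop :=
  T ∘L ContinuousLinearMap.adjoint T = ContinuousLinearMap.id ℂ H

end Spaces

section Conditions

variable {X : Type*} (H : Type*) [NormedAddCommGroup H] [InnerProductSpace ℂ H] [RKHS ℂ H X ℂ]
  {d : ℕ∞} (b : X → Ball d) (δ : X → ℂ)

/-- (i) `k(z, w) = δ(z) * conj δ(w) / (1 - ⟨b(z), b(w)⟩)` for all `z, w ∈ X`. -/
def KernelFactorization [CompleteSpace H] : Prop :=
  ∀ z w : X, scalarKernel H z w =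
    δ z * conj (δ w) / (1 - pairing (b z : Cd d) (b w : Cd d))

/-- (i') `f ↦ δ · (f ∘ b)` defines a co-isometry `H²_d → H`. -/
def CoisometricEmbedding [CompleteSpace H] : Prop :=
  ∃ T : DruryArveson d →L[ℂ] H, IsWeightedComp δ b T ∧ IsCoisometry T

/-- (i'') `f ↦ δ · (f ∘ b)` defines a unitary `H²_d|_V → H`, where `V = b(X)`. -/
def UnitaryEmbedding : Prop :=
  ∃ U : DruryArvesonOn (Set.range b) ≃ₗᵢ[ℂ] H, IsWeightedComp δ (Set.rangeFactorization b) U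

/-- (ii) `f ↦ δ · (f ∘ b)` defines a surjection `H²_d → H`. -/
def SurjectiveEmbedding : Prop :=
  ∃ T : DruryArveson d → H, IsWeightedComp δ b T ∧ Function.Surjective T

/-- (ii') `f ↦ δ · (f ∘ b)` defines a bijection `H²_d|_V → H`, where `V = b(X)`. -/
def BijectiveEmbedding : Prop :=
  ∃ T : DruryArvesonOn (Set.range b) → H,
    IsWeightedComp δ (Set.rangeFactorization b) T ∧ Function.Bijective T

/-- (iii) `φ ↦ φ ∘ b` defines a surjection `Mult(H²_d) → Mult(H)`. -/
def MultSurjectiveEmbedding : Prop :=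
  ∃ Φ : Mult (DruryArveson d) → Mult H, IsMultComp b Φ ∧ Function.Surjective Φ

/-- (iii') `φ ↦ φ ∘ b` defines a bijection `Mult(H²_d|_V) → Mult(H)`, where `V = b(X)`. -/
def MultBijectiveEmbedding : Prop :=
  ∃ Φ : Mult (DruryArvesonOn (Set.range b)) → Mult H,
    IsMultComp (Set.rangeFactorization b) Φ ∧ Function.Bijective Φ

end Conditions

end EmbRKHS

end

/-! The adjoint of `f ↦ δ · (f ∘ b)` sends `k(·, x)` to `conj (δ x)` times the kernel function at `b
x`. Testing `T T* = I` on kernel functions therefore gives exactly the kernel identity (i);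
conversely (i) makes this assignment on kernel functions inner-product preserving, so it extends to
an operator whose adjoint is `T` (`exists_coisometry_iff`). Over `V = b(X)` the map is injective
because `δ` has no zeros, which turns co-isometries into unitaries. With `δ = 1` and an inclusion,
the same criterion shows that restriction `H²_d → H²_d|_V` is onto, whence (ii) ⇔ (ii'). A bijection
as in (ii') intertwines multiplication by `φ` and by `φ ∘ b`, and separation of points makes `b`
injective, so multipliers correspond.

The deep point is (iii) ⇔ (iii'): each multiplier `φ` on `V` extends to the ball
(`exists_mult_extension`). For contractive `φ` the defect of the adjoint multiplication operator
gives `1 - φ(z) conj φ(w) = (1 - ⟨z, w⟩) ⟨l z, l w⟩`. Rearranged, this is a lurking isometry;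
extended to a contraction `U`, it has a transfer function on the whole ball that agrees with `φ` on
`V` and is a multiplier by the Schur product theorem. -/

open scoped ComplexConjugate

noncomputable section

namespace EmbRKHS

/-! ### Extending maps on families of vectors to contractions -/

section Contraction

variable {ι A B : Type*} [NormedAddCommGroup A] [InnerProductSpace ℂ A] [CompleteSpace A]
  [NormedAddCommGroup B] [InnerProductSpace ℂ B] [CompleteSpace B]

/-- A map between families of vectors that contracts all linear combinations extends to a
contraction. -/
theorem exists_contraction (v : ι → A) (u : ι → B)
    (h : ∀ c : ι →₀ ℂ, ‖Finsupp.linearCombination ℂ u c‖ ≤ ‖Finsupp.linearCombination ℂ v c‖) :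
    ∃ U : A →L[ℂ] B, (∀ a, ‖U a‖ ≤ ‖a‖) ∧ ∀ i, U (v i) = u i := by
  let R := LinearMap.range (Finsupp.linearCombination ℂ v)
  let S := R.topologicalClosure
  have hmem : ∀ c, Finsupp.linearCombination ℂ v c ∈ S := fun c =>
    R.le_topologicalClosure (LinearMap.mem_range_self _ c)
  let e : (ι →₀ ℂ) →ₗ[ℂ] S := (Finsupp.linearCombination ℂ v).codRestrict S hmem
  have hdense : DenseRange e := by
    rintro ⟨x, hx⟩
    rw [closure_subtype]
    have hx' : x ∈ closure (R : Set A) := hx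
    refine closure_mono ?_ hx'
    rintro _ ⟨c, rfl⟩
    exact ⟨e c, ⟨c, rfl⟩, rfl⟩
  have hnorm : ∀ c, ‖Finsupp.linearCombination ℂ u c‖ ≤ 1 * ‖e c‖ := fun c => by
    rw [one_mul]; exact h c
  have : CompleteSpace S := R.isClosed_topologicalClosure.completeSpace_coe
  -- Extend by continuity to the closed span of `v`, and by zero on its orthogonal complement.
  refine ⟨(Finsupp.linearCombination ℂ u).extendOfNorm e ∘L S.orthogonalProjectionOnto,
    fun a => ?_, fun i => ?_⟩
  · refine (LinearMap.norm_extendOfNorm_apply_le hdense 1 hnorm _).trans ?_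
    rw [one_mul]
    exact S.norm_orthogonalProjectionOnto_apply_le a
  · have hi : v i = (e (Finsupp.single i 1) : A) := by simp [e]
    rw [ContinuousLinearMap.comp_apply, hi, S.orthogonalProjectionOnto_mem_subspace_eq_self,
      LinearMap.extendOfNorm_eq hdense ⟨1, hnorm⟩]
    simp

omit [CompleteSpace A] in
theorem inner_linearCombination (v : ι → A) (c : ι →₀ ℂ) :
    inner ℂ (Finsupp.linearCombination ℂ v c) (Finsupp.linearCombination ℂ v c) =
      ∑ i ∈ c.support, ∑ j ∈ c.support, conj (c i) * c j * inner ℂ (v i) (v j) := by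
  simp only [Finsupp.linearCombination_apply, Finsupp.sum, sum_inner, inner_sum, inner_smul_left,
    inner_smul_right, Finset.mul_sum]
  rw [Finset.sum_comm]
  refine Finset.sum_congr rfl fun i _ => Finset.sum_congr rfl fun j _ => ?_
  ring

omit [CompleteSpace A] in
theorem norm_sq_linearCombination (v : ι → A) (c : ι →₀ ℂ) :
    ‖Finsupp.linearCombination ℂ v c‖ ^ 2 =
      (∑ i ∈ c.support, ∑ j ∈ c.support, conj (c i) * c j * inner ℂ (v i) (v j)).re := by
  rw [← inner_linearCombination]
  exact (inner_self_eq_norm_sq (𝕜 := ℂ) _).symm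

/-- A map between families of vectors that preserves inner products extends to a contraction. -/
theorem exists_contraction_of_inner_eq (v : ι → A) (u : ι → B)
    (h : ∀ i j, inner ℂ (u i) (u j) = inner ℂ (v i) (v j)) :
    ∃ U : A →L[ℂ] B, (∀ a, ‖U a‖ ≤ ‖a‖) ∧ ∀ i, U (v i) = u i := by
  refine exists_contraction v u fun c => ?_
  refine le_of_sq_le_sq ?_ (norm_nonneg _)
  simp only [norm_sq_linearCombination, h, le_refl]

end Contraction

/-! ### Weighted composition operators and kernel functions -/

section General

variable {X Y H G : Type*} [NormedAddCommGroup H] [InnerProductSpace ℂ H] [CompleteSpace H]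
  [RKHS ℂ H X ℂ] [NormedAddCommGroup G] [InnerProductSpace ℂ G] [CompleteSpace G] [RKHS ℂ G Y ℂ]

/-- The kernel function `k(·, x)`. -/
def kerVec (H : Type*) {X : Type*} [NormedAddCommGroup H] [InnerProductSpace ℂ H]
    [CompleteSpace H] [RKHS ℂ H X ℂ] (x : X) : H := RKHS.kerFun H x 1

theorem inner_kerVec_left (x : X) (f : H) : inner ℂ (kerVec H x) f = f x := by
  simp [kerVec]

theorem kerVec_apply (z w : X) : kerVec H w z = scalarKernel H z w := by
  simp [kerVec, scalarKernel, RKHS.kerFun_apply]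

theorem inner_kerVec (z w : X) : inner ℂ (kerVec H z) (kerVec H w) = scalarKernel H z w := by
  rw [inner_kerVec_left, kerVec_apply]

/-- A weighted composition map between reproducing kernel Hilbert spaces is linear and bounded. -/
theorem IsWeightedComp.exists_clm {δ : X → ℂ} {b : X → Y} {T : G → H}
    (hT : IsWeightedComp δ b T) : ∃ T' : G →L[ℂ] H, ∀ f, T' f = T f := by
  let L : G →ₗ[ℂ] H :=
    { toFun := T
      map_add' := fun f g => by
        ext x
        simp [hT _ x, mul_add]
      map_smul' := fun c f => by
        ext x
        simp [hT _ x, mul_left_comm] }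
  -- Closed graph theorem: continuity of point evaluations identifies the limit pointwise.
  refine ⟨ContinuousLinearMap.ofSeqClosedGraph (g := L) fun u f g hu hg => ?_, fun f => rfl⟩
  ext x
  have h1 : Filter.Tendsto (fun n => (L (u n)) x) Filter.atTop (nhds (g x)) :=
    ((RKHS.continuous_eval x).tendsto g).comp hg
  have h2 : Filter.Tendsto (fun n => (L (u n)) x) Filter.atTop (nhds (L f x)) := by
    have : ∀ f, (L f) x = δ x * f (b x) := fun f => hT f x
    simp only [this]
    exact (((RKHS.continuous_eval (b x)).tendsto f).comp hu).const_mul _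
  exact tendsto_nhds_unique h1 h2

theorem IsWeightedComp.adjoint_kerVec {δ : X → ℂ} {b : X → Y} {T : G →L[ℂ] H}
    (hT : IsWeightedComp δ b T) (x : X) :
    ContinuousLinearMap.adjoint T (kerVec H x) = conj (δ x) • kerVec G (b x) := by
  refine ext_inner_right ℂ fun f => ?_
  rw [ContinuousLinearMap.adjoint_inner_left, inner_kerVec_left, hT, inner_smul_left,
    inner_kerVec_left, RCLike.conj_conj]

/-- An operator sending kernel functions to multiples of kernel functions is the adjoint of a
weighted composition operator. -/
theorem isWeightedComp_adjoint {δ : X → ℂ} {b : X → Y} {S : H →L[ℂ] G}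
    (hS : ∀ x, S (kerVec H x) = conj (δ x) • kerVec G (b x)) :
    IsWeightedComp δ b (ContinuousLinearMap.adjoint S) := by
  intro f x
  rw [← inner_kerVec_left (H := H), ContinuousLinearMap.adjoint_inner_right, hS, inner_smul_left,
    inner_kerVec_left, RCLike.conj_conj]

/-- A weighted composition map is a co-isometry if and only if the kernels are related by the
corresponding rescaling. -/
theorem exists_coisometry_iff (δ : X → ℂ) (b : X → Y) :
    (∃ T : G →L[ℂ] H, IsWeightedComp δ b T ∧ IsCoisometry T) ↔
      ∀ z w, scalarKernel H z w = δ z * conj (δ w) * scalarKernel G (b z) (b w) := by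
  constructor
  · rintro ⟨T, hT, hco⟩ z w
    have h : inner ℂ (kerVec H z) (T (ContinuousLinearMap.adjoint T (kerVec H w))) =
        scalarKernel H z w := by
      rw [← inner_kerVec]
      congr 1
      exact congrArg (fun A : H →L[ℂ] H => A (kerVec H w)) hco
    rw [← h, inner_kerVec_left, hT, hT.adjoint_kerVec, RKHS.coe_smul, Pi.smul_apply,
      kerVec_apply, smul_eq_mul, mul_assoc]
  · intro h
    -- `S` is the future `T*`; only its values on kernel functions are used.
    obtain ⟨S, -, hS⟩ := exists_contraction_of_inner_eq (kerVec H)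
      (fun x => conj (δ x) • kerVec G (b x)) fun z w => by
        rw [inner_smul_left, inner_smul_right, inner_kerVec, inner_kerVec, h, RCLike.conj_conj,
          mul_assoc]
    have hT := isWeightedComp_adjoint hS
    refine ⟨_, hT, ?_⟩
    rw [IsCoisometry, ContinuousLinearMap.adjoint_adjoint]
    ext f x
    rw [← inner_kerVec_left, ContinuousLinearMap.comp_apply,
      ContinuousLinearMap.adjoint_inner_right, ← ContinuousLinearMap.adjoint_inner_left]
    have : ContinuousLinearMap.adjoint S (S (kerVec H x)) = kerVec H x := by
      ext z
      rw [hT, hS, RKHS.coe_smul, Pi.smul_apply, kerVec_apply, kerVec_apply, h, smul_eq_mul,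
        mul_assoc]
    rw [this, inner_kerVec_left]
    rfl

omit [CompleteSpace H] [CompleteSpace G] in
theorem IsWeightedComp.injective {δ : X → ℂ} {b : X → Y} {T : G → H}
    (hT : IsWeightedComp δ b T) (hδ : ∀ x, δ x ≠ 0) (hb : Function.Surjective b) :
    Function.Injective T := by
  intro f g hfg
  ext y
  obtain ⟨x, rfl⟩ := hb y
  exact mul_left_cancel₀ (hδ x) (by rw [← hT, ← hT, hfg])

theorem IsCoisometry.surjective {T : G →L[ℂ] H} (hT : IsCoisometry T) : Function.Surjective T :=
  fun f => ⟨ContinuousLinearMap.adjoint T f, congrArg (fun A : H →L[ℂ] H => A f) hT⟩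

/-- An injective co-isometry is unitary. -/
theorem IsCoisometry.exists_unitary {T : G →L[ℂ] H} (hT : IsCoisometry T)
    (hinj : Function.Injective T) : ∃ U : G ≃ₗᵢ[ℂ] H, ∀ f, U f = T f := by
  -- `T (T* T f) = T f`, so injectivity upgrades `T T* = I` to `T* T = I`.
  have h2 : ∀ f, ContinuousLinearMap.adjoint T (T f) = f := fun f =>
    hinj (congrArg (fun A : H →L[ℂ] H => A (T f)) hT)
  have hnorm : ∀ f, ‖T f‖ = ‖f‖ := by
    rw [T.norm_map_iff_adjoint_comp_self]
    ext1 f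
    exact h2 f
  exact ⟨LinearIsometryEquiv.ofSurjective ⟨T.toLinearMap, hnorm⟩ hT.surjective, fun f => rfl⟩

theorem isCoisometry_of_unitary (U : G ≃ₗᵢ[ℂ] H) :
    IsCoisometry (U.toContinuousLinearEquiv : G →L[ℂ] H) := by
  rw [IsCoisometry, LinearIsometryEquiv.adjoint_eq_symm]
  ext1 f
  simp

/-- Operators sending kernel functions to scalar multiples of themselves give multipliers. -/
theorem mem_mult_of_kerVec {φ : X → ℂ} {S : H →L[ℂ] H}
    (hS : ∀ x, S (kerVec H x) = conj (φ x) • kerVec H x) : φ ∈ Mult H := fun f =>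
  ⟨ContinuousLinearMap.adjoint S f, fun x => isWeightedComp_adjoint (b := id) hS f x⟩

/-- Multiplication operators are bounded. -/
theorem exists_mulOperator (φ : Mult H) :
    ∃ M : H →L[ℂ] H, IsWeightedComp (φ : X → ℂ) id M := by
  choose M hM using φ.2
  have hM' : IsWeightedComp (φ : X → ℂ) id M := hM
  obtain ⟨M', h⟩ := hM'.exists_clm
  exact ⟨M', fun f x => by rw [h, hM' f x]⟩

end General

/-! ### Defect operators and Schur products -/

section Defect

variable {A B : Type*} [NormedAddCommGroup A] [InnerProductSpace ℂ A] [CompleteSpace A]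
  [NormedAddCommGroup B] [InnerProductSpace ℂ B] [CompleteSpace B]

open scoped ComplexOrder in
/-- The defect operator of a contraction. -/
theorem exists_defect (U : A →L[ℂ] B) (hU : ∀ a, ‖U a‖ ≤ ‖a‖) :
    ∃ D : A →L[ℂ] A, ∀ a b, inner ℂ (D a) (D b) = inner ℂ a b - inner ℂ (U a) (U b) := by
  let P : A →L[ℂ] A := ContinuousLinearMap.id ℂ A - ContinuousLinearMap.adjoint U ∘L U
  have hP : ∀ a b, inner ℂ a (P b) = inner ℂ a b - inner ℂ (U a) (U b) := fun a b => by
    simp [P, ContinuousLinearMap.adjoint_inner_right]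
  have hP' : ∀ a b, inner ℂ (P a) b = inner ℂ a b - inner ℂ (U a) (U b) := fun a b => by
    simp [P, ContinuousLinearMap.adjoint_inner_left]
  have hpos : 0 ≤ P := by
    rw [ContinuousLinearMap.nonneg_iff_isPositive, ContinuousLinearMap.isPositive_iff']
    refine ⟨?_, fun a => ?_⟩
    · rw [ContinuousLinearMap.isSelfAdjoint_iff_isSymmetric]
      intro a b
      exact (hP' a b).trans (hP a b).symm
    · rw [hP', inner_self_eq_norm_sq_to_K, inner_self_eq_norm_sq_to_K]
      have h := pow_le_pow_left₀ (norm_nonneg _) (hU a) 2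
      have h' : (0 : ℂ) ≤ ((‖a‖ ^ 2 - ‖U a‖ ^ 2 : ℝ) : ℂ) := by
        rw [Complex.zero_le_real]
        linarith
      simpa using h'
  -- `D = (I - U* U)^(1/2)`.
  refine ⟨CFC.sqrt P, fun a b => ?_⟩
  have hsa : IsSelfAdjoint (CFC.sqrt P) := (CFC.sqrt_nonneg P).isSelfAdjoint
  rw [← ContinuousLinearMap.adjoint_inner_right, ← ContinuousLinearMap.star_eq_adjoint,
    hsa.star_eq, ← hP]
  congr 1
  exact congrArg (fun Q : A →L[ℂ] A => Q b) (CFC.sqrt_mul_sqrt_self P hpos)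

open scoped ComplexOrder in
omit [CompleteSpace A] [CompleteSpace B] in
/-- Schur product theorem for Gram matrices. -/
theorem gram_mul_gram_nonneg {ι : Type*} (v : ι → A) (w : ι → B) (c : ι →₀ ℂ) :
    0 ≤ (∑ i ∈ c.support, ∑ j ∈ c.support,
      conj (c i) * c j * (inner ℂ (v i) (v j) * inner ℂ (w i) (w j))).re := by
  have key := (Matrix.posSemidef_gram ℂ (fun i : c.support => v i)).hadamard
    (Matrix.posSemidef_gram ℂ (fun i : c.support => w i))
  have h := (RCLike.le_iff_re_im.1 (key.dotProduct_mulVec_nonneg fun i => c i)).1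
  rw [← Finset.sum_coe_sort]
  simp_rw [← Finset.sum_coe_sort c.support]
  rw [map_zero] at h
  refine h.trans_eq (congrArg Complex.re ?_)
  simp only [dotProduct, Matrix.mulVec, Finset.mul_sum, Matrix.hadamard_apply, Matrix.gram_apply,
    Pi.star_apply, RCLike.star_def]
  refine Finset.sum_congr rfl fun i _ => Finset.sum_congr rfl fun j _ => ?_
  ring

end Defect

/-! ### Conjugate tensors and the state equation -/

section Tensor

variable {d : ℕ∞} {E : Type*} [NormedAddCommGroup E] [InnerProductSpace ℂ E]

theorem memℓp_conj_smul (z : Cd d) (e : E) :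
    Memℓp (fun n : {n : ℕ // (n : ℕ∞) < d} => conj (z n) • e) 2 := by
  have h := ((lp.memℓp z).summable (by norm_num)).mul_right (‖e‖ ^ (2 : ENNReal).toReal)
  refine memℓp_gen (h.congr fun n => ?_)
  rw [norm_smul, RCLike.norm_conj, Real.mul_rpow (norm_nonneg _) (norm_nonneg _)]

/-- The elementary tensor of the conjugate of `z` with `e`, as a family of multiples of `e`. -/
def conjTensor (z : Cd d) (e : E) : lp (fun _ : {n : ℕ // (n : ℕ∞) < d} => E) 2 :=
  ⟨fun n => conj (z n) • e, memℓp_conj_smul z e⟩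

theorem conjTensor_sub (z : Cd d) (e f : E) :
    conjTensor z (e - f) = conjTensor z e - conjTensor z f := by
  ext n
  exact smul_sub _ _ _

/-- Conjugating the coordinates compensates for `inner` being antilinear in its first variable, so
`⟨z, w⟩` appears in the right order. -/
theorem inner_conjTensor (z w : Cd d) (e f : E) :
    inner ℂ (conjTensor z e) (conjTensor w f) = pairing z w * inner ℂ e f := by
  rw [pairing, lp.inner_eq_tsum, lp.inner_eq_tsum, ← tsum_mul_right]
  refine tsum_congr fun n => ?_
  simp [conjTensor, inner_smul_left, inner_smul_right]
  ring

theorem norm_conjTensor (z : Cd d) (e : E) : ‖conjTensor z e‖ = ‖z‖ * ‖e‖ := by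
  have h := inner_conjTensor z z e e
  rw [pairing, inner_self_eq_norm_sq_to_K, inner_self_eq_norm_sq_to_K,
    inner_self_eq_norm_sq_to_K] at h
  refine (sq_eq_sq₀ (norm_nonneg _) (by positivity)).1 ?_
  rw [mul_pow]
  exact_mod_cast h

variable [CompleteSpace E]

/-- The state equation of a contractive colligation is uniquely solvable at each point of the
ball. -/
theorem existsUnique_state
    (U : WithLp 2 (ℂ × lp (fun _ : {n : ℕ // (n : ℕ∞) < d} => E) 2) →L[ℂ] WithLp 2 (ℂ × E))
    (hU : ∀ a, ‖U a‖ ≤ ‖a‖) (z : Ball d) :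
    ∃! e : E, (U (WithLp.toLp 2 (1, conjTensor (z : Cd d) e))).snd = e := by
  have hz : ‖(z : Cd d)‖ < 1 := mem_ball_zero_iff.1 z.2
  let f : E → E := fun e => (U (WithLp.toLp 2 (1, conjTensor (z : Cd d) e))).snd
  have hf : ContractingWith ‖(z : Cd d)‖₊ f := by
    refine ⟨by exact_mod_cast hz, LipschitzWith.of_dist_le_mul fun x y => ?_⟩
    rw [dist_eq_norm, dist_eq_norm, coe_nnnorm, ← norm_conjTensor]
    -- The constant entry `1` cancels in differences, leaving a vector of norm `‖z‖ * ‖x - y‖`.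
    have h1 : f x - f y = (U (WithLp.toLp 2 (0, conjTensor (z : Cd d) (x - y)))).snd := by
      simp only [f]
      rw [← WithLp.sub_snd, ← map_sub, ← WithLp.toLp_sub, Prod.mk_sub_mk, sub_self,
        conjTensor_sub]
    rw [h1]
    refine (WithLp.norm_snd_le _ _).trans ((hU _).trans ?_)
    rw [WithLp.norm_toLp_snd]
  exact ⟨ContractingWith.fixedPoint f hf, hf.fixedPoint_isFixedPt,
    fun e he => hf.fixedPoint_unique he⟩

end Tensor

/-! ### Transfer functions and extension of multipliers -/

theorem one_sub_pairing_ne_zero {d : ℕ∞} (z w : Ball d) :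
    1 - pairing (z : Cd d) (w : Cd d) ≠ 0 := by
  intro h
  have := norm_pairing_lt_one z w
  rw [← sub_eq_zero.1 h] at this
  simp at this

theorem scalarKernel_druryArveson {d : ℕ∞} (z w : Ball d) :
    scalarKernel (DruryArveson d) z w = 1 / (1 - pairing (z : Cd d) (w : Cd d)) := by
  rw [scalarKernel, RKHS.OfKernel.kernel_ofKernel]
  simp [daKernel]

theorem scalarKernel_druryArvesonOn {d : ℕ∞} {V : Set (Ball d)} (z w : V) :
    scalarKernel (DruryArvesonOn V) z w =
      1 / (1 - pairing ((z : Ball d) : Cd d) ((w : Ball d) : Cd d)) := by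
  rw [scalarKernel, RKHS.OfKernel.kernel_ofKernel]
  simp [daKernelOn, daKernel]

/-- The transfer function of a contractive colligation is a multiplier of the Drury--Arveson
space. -/
theorem transferFunction_mem_mult {d : ℕ∞} {E : Type*} [NormedAddCommGroup E]
    [InnerProductSpace ℂ E] [CompleteSpace E]
    (U : WithLp 2 (ℂ × lp (fun _ : {n : ℕ // (n : ℕ∞) < d} => E) 2) →L[ℂ] WithLp 2 (ℂ × E))
    (hU : ∀ a, ‖U a‖ ≤ ‖a‖) (φ : Ball d → ℂ) (l : Ball d → E)
    (h : ∀ z : Ball d, U (WithLp.toLp 2 (1, conjTensor (z : Cd d) (l z))) =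
      WithLp.toLp 2 (conj (φ z), l z)) :
    φ ∈ Mult (DruryArveson d) := by
  obtain ⟨D, hD⟩ := exists_defect U hU
  let v : Ball d → WithLp 2 (ℂ × lp (fun _ : {n : ℕ // (n : ℕ∞) < d} => E) 2) := fun z =>
    WithLp.toLp 2 (1, conjTensor (z : Cd d) (l z))
  have hv : ∀ z w, inner ℂ (D (v z)) (D (v w)) =
      (1 - φ z * conj (φ w)) - (1 - pairing (z : Cd d) (w : Cd d)) * inner ℂ (l z) (l w) := by
    intro z w
    rw [hD, h, h]
    simp only [v, WithLp.prod_inner_apply, inner_conjTensor, RCLike.inner_apply, map_one,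
      RCLike.conj_conj]
    ring
  -- This is `hv` multiplied by `K(z, w)`. The last two summands are positive kernels, the second of
  -- them by Schur, so dropping them yields the contraction estimate for `S`.
  have hk : ∀ z w, inner ℂ (kerVec (DruryArveson d) z) (kerVec (DruryArveson d) w) =
      inner ℂ (conj (φ z) • kerVec (DruryArveson d) z) (conj (φ w) • kerVec (DruryArveson d) w) +
      inner ℂ (l z) (l w) +
      inner ℂ (kerVec (DruryArveson d) z) (kerVec (DruryArveson d) w) *
        inner ℂ (D (v z)) (D (v w)) := by
    intro z w
    rw [hv, inner_smul_left, inner_smul_right, inner_kerVec, scalarKernel_druryArveson,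
      RCLike.conj_conj]
    have := one_sub_pairing_ne_zero z w
    field_simp
    ring
  obtain ⟨S, -, hS⟩ := exists_contraction (kerVec (DruryArveson d))
    (fun z => conj (φ z) • kerVec (DruryArveson d) z) fun c => by
      refine le_of_sq_le_sq ?_ (norm_nonneg _)
      have h1 := norm_sq_linearCombination (kerVec (DruryArveson d)) c
      rw [Finset.sum_congr rfl fun i _ => Finset.sum_congr rfl fun j _ =>
        congrArg (conj (c i) * c j * ·) (hk i j)] at h1
      simp only [mul_add, Finset.sum_add_distrib, Complex.add_re] at h1
      rw [← norm_sq_linearCombination, ← norm_sq_linearCombination l] at h1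
      have h2 := gram_mul_gram_nonneg (kerVec (DruryArveson d)) (fun z => D (v z)) c
      rw [h1]
      linarith [sq_nonneg ‖Finsupp.linearCombination ℂ l c‖]
  exact mem_mult_of_kerVec hS

/-- The Pick property of the Drury--Arveson space: a contractive multiplier of a restriction
extends to a multiplier on the whole ball. -/
theorem exists_extension_of_contractive {d : ℕ∞} {V : Set (Ball d)} (φ : V → ℂ)
    (S : DruryArvesonOn V →L[ℂ] DruryArvesonOn V) (hS : ∀ a, ‖S a‖ ≤ ‖a‖)
    (hφ : ∀ x, S (kerVec (DruryArvesonOn V) x) = conj (φ x) • kerVec (DruryArvesonOn V) x) :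
    ∃ ψ ∈ Mult (DruryArveson d), ∀ x : V, ψ x = φ x := by
  obtain ⟨D, hD⟩ := exists_defect S hS
  let l : V → DruryArvesonOn V := fun x => D (kerVec _ x)
  have hl : ∀ z w : V, (1 - pairing ((z : Ball d) : Cd d) ((w : Ball d) : Cd d)) *
      inner ℂ (l z) (l w) = 1 - φ z * conj (φ w) := by
    intro z w
    have := one_sub_pairing_ne_zero (z : Ball d) w
    rw [hD, hφ, hφ, inner_smul_left, inner_smul_right, inner_kerVec, scalarKernel_druryArvesonOn,
      RCLike.conj_conj]
    field_simp
  -- Lurking isometry: `hl` reads `1 + ⟨z, w⟩ ⟨l z, l w⟩ = φ(z) conj φ(w) + ⟨l z, l w⟩`.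
  obtain ⟨U, hU, hUv⟩ := exists_contraction_of_inner_eq
    (fun x : V => WithLp.toLp 2 ((1 : ℂ), conjTensor ((x : Ball d) : Cd d) (l x)))
    (fun x : V => WithLp.toLp 2 (conj (φ x), l x)) fun z w => by
      have := hl z w
      simp only [WithLp.prod_inner_apply, inner_conjTensor, RCLike.inner_apply, map_one,
        RCLike.conj_conj]
      linear_combination this
  choose L hL hLu using existsUnique_state U hU
  refine ⟨fun z => conj (U (WithLp.toLp 2 (1, conjTensor (z : Cd d) (L z)))).fst,
    transferFunction_mem_mult U hU _ L fun z => ?_, fun x => ?_⟩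
  · rw [RCLike.conj_conj]
    exact WithLp.ofLp_injective 2 (Prod.ext rfl (hL z))
  -- On `V` the vector `l x` already solves the state equation, so uniqueness forces agreement with
  -- `φ`.
  · have hx : l x = L x := hLu x (l x) (congrArg WithLp.snd (hUv x))
    change conj (U (WithLp.toLp 2 (1, conjTensor ((x : Ball d) : Cd d) (L x)))).fst = φ x
    rw [← hx, hUv]
    exact RCLike.conj_conj _

/-- Every multiplier of `H²_d|_V` extends to a multiplier of `H²_d`. -/
theorem exists_mult_extension {d : ℕ∞} {V : Set (Ball d)} (φ : Mult (DruryArvesonOn V)) :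
    ∃ ψ : Mult (DruryArveson d), ∀ x : V, (ψ : Ball d → ℂ) x = (φ : V → ℂ) x := by
  obtain ⟨M, hM⟩ := exists_mulOperator φ
  let S := ContinuousLinearMap.adjoint M
  -- Dividing by `‖S‖ + 1` makes `S` contractive and stays legitimate when `S = 0`.
  have hr : 0 < ‖S‖ + 1 := by positivity
  have hr' : ((‖S‖ + 1 : ℝ) : ℂ) ≠ 0 := by exact_mod_cast hr.ne'
  obtain ⟨ψ, hψ, h⟩ := exists_extension_of_contractive
    (fun x => (((‖S‖ + 1 : ℝ) : ℂ)⁻¹ * (φ : V → ℂ) x)) (((‖S‖ + 1 : ℝ) : ℂ)⁻¹ • S)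
    (fun a => by
      rw [smul_apply, norm_smul, norm_inv, Complex.norm_real,
        Real.norm_of_nonneg hr.le, inv_mul_le_iff₀ hr]
      exact (S.le_opNorm a).trans (by gcongr; linarith))
    (fun x => by
      rw [smul_apply, hM.adjoint_kerVec, smul_smul, map_mul, map_inv₀,
        Complex.conj_ofReal]
      rfl)
  refine ⟨((‖S‖ + 1 : ℝ) : ℂ) • ⟨ψ, hψ⟩, fun x => ?_⟩
  change ((‖S‖ + 1 : ℝ) : ℂ) * ψ x = _
  rw [h, mul_inv_cancel_left₀ hr']

/-! ### Restriction to subsets of the ball -/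

section Restriction

variable {d : ℕ∞} {V : Set (Ball d)}

/-- Restriction to `V` maps `H²_d` onto `H²_d|_V`. -/
theorem exists_restriction (V : Set (Ball d)) :
    ∃ R : DruryArveson d →L[ℂ] DruryArvesonOn V,
      (∀ f (x : V), R f x = f x) ∧ Function.Surjective R := by
  obtain ⟨R, hR, hco⟩ := (exists_coisometry_iff (H := DruryArvesonOn V) (G := DruryArveson d)
    (fun _ => 1) (fun x : V => (x : Ball d))).2 fun z w => by
      rw [scalarKernel_druryArveson, scalarKernel_druryArvesonOn, map_one, one_mul, one_mul]
  exact ⟨R, fun f x => by rw [hR, one_mul], hco.surjective⟩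

/-- The restriction to `V` of a multiplier of `H²_d` is a multiplier of `H²_d|_V`. -/
theorem restrict_mem_mult (φ : Mult (DruryArveson d)) :
    (fun x : V => (φ : Ball d → ℂ) x) ∈ Mult (DruryArvesonOn V) := by
  obtain ⟨R, hR, hsurj⟩ := exists_restriction V
  intro f
  obtain ⟨F, rfl⟩ := hsurj f
  obtain ⟨g, hg⟩ := φ.2 F
  exact ⟨R g, fun x => by rw [hR, hR, hg]⟩

end Restriction

/-! ### The equivalences and implications -/

section Embeddings

variable {X H : Type*} [NormedAddCommGroup H] [InnerProductSpace ℂ H] [RKHS ℂ H X ℂ]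
  {d : ℕ∞} {b : X → Ball d} {δ : X → ℂ}

theorem kernelFactorization_iff_coisometricEmbedding [CompleteSpace H] :
    KernelFactorization H b δ ↔ CoisometricEmbedding H b δ := by
  rw [CoisometricEmbedding, exists_coisometry_iff]
  refine forall₂_congr fun z w => ?_
  rw [scalarKernel_druryArveson, mul_one_div]

theorem kernelFactorization_iff_unitaryEmbedding [CompleteSpace H] (hδ : ∀ x, δ x ≠ 0) :
    KernelFactorization H b δ ↔ UnitaryEmbedding H b δ := by
  have key : (∃ T : DruryArvesonOn (Set.range b) →L[ℂ] H,
      IsWeightedComp δ (Set.rangeFactorization b) T ∧ IsCoisometry T) ↔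
      KernelFactorization H b δ := by
    rw [exists_coisometry_iff]
    refine forall₂_congr fun z w => ?_
    rw [scalarKernel_druryArvesonOn, mul_one_div]
    rfl
  rw [← key]
  constructor
  · rintro ⟨T, hT, hco⟩
    obtain ⟨U, hU⟩ := hco.exists_unitary (hT.injective hδ Set.rangeFactorization_surjective)
    exact ⟨U, fun f x => by rw [hU, hT]⟩
  · rintro ⟨U, hU⟩
    exact ⟨_, hU, isCoisometry_of_unitary U⟩

theorem UnitaryEmbedding.bijectiveEmbedding (h : UnitaryEmbedding H b δ) :
    BijectiveEmbedding H b δ := by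
  obtain ⟨U, hU⟩ := h
  exact ⟨U, hU, U.bijective⟩

theorem surjectiveEmbedding_iff_bijectiveEmbedding (hδ : ∀ x, δ x ≠ 0) :
    SurjectiveEmbedding H b δ ↔ BijectiveEmbedding H b δ := by
  obtain ⟨R, hR, hsurj⟩ := exists_restriction (Set.range b)
  constructor
  · rintro ⟨T, hT, hTs⟩
    -- Any choice of extensions works, without linearity: `T f` depends only on `f` restricted to
    -- `V`.
    choose F hF using hsurj
    have hT' : IsWeightedComp δ (Set.rangeFactorization b) fun f => T (F f) := fun f x => by
      rw [hT]
      conv_rhs => rw [← hF f, hR]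
      rfl
    refine ⟨_, hT', hT'.injective hδ Set.rangeFactorization_surjective, fun g => ?_⟩
    obtain ⟨f, rfl⟩ := hTs g
    refine ⟨R f, ?_⟩
    ext x
    rw [hT', hT, hR]
    rfl
  · rintro ⟨T, hT, hTb⟩
    refine ⟨fun f => T (R f), fun f x => ?_, hTb.surjective.comp hsurj⟩
    rw [hT, hR]
    rfl

/-- A weighted composition map onto a point-separating space has injective symbol. -/
theorem BijectiveEmbedding.injective (hsep : SeparatesPoints H) (h : BijectiveEmbedding H b δ) :
    Function.Injective b := by
  obtain ⟨T, hT, -, hTs⟩ := h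
  intro z w hzw
  by_contra hne
  obtain ⟨f, hz, hw⟩ := hsep z w hne
  obtain ⟨g, rfl⟩ := hTs f
  -- If `δ z = 0`, every function in the range of `T` would vanish at `z`, contradicting separation.
  have hδz : δ z ≠ 0 := by
    intro h0
    obtain ⟨f, -, hz'⟩ := hsep w z (Ne.symm hne)
    obtain ⟨g', rfl⟩ := hTs f
    rw [hT, h0, zero_mul] at hz'
    exact zero_ne_one hz'
  rw [hT] at hz hw
  have hzw' : Set.rangeFactorization b z = Set.rangeFactorization b w := Subtype.ext hzw
  rw [← hzw', (mul_eq_zero.1 hz).resolve_left hδz, mul_zero] at hw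
  exact zero_ne_one hw

theorem BijectiveEmbedding.multBijectiveEmbedding (hsep : SeparatesPoints H)
    (hδ : ∀ x, δ x ≠ 0) (h : BijectiveEmbedding H b δ) : MultBijectiveEmbedding H b := by
  have hb : Function.Bijective (Set.rangeFactorization b) :=
    Set.rangeFactorization_bijective.2 (h.injective hsep)
  obtain ⟨T, hT, -, hTs⟩ := h
  refine ⟨fun φ => ⟨fun x => (φ : Set.range b → ℂ) (Set.rangeFactorization b x), fun f => ?_⟩,
    fun φ x => rfl, fun φ ψ h => ?_, fun ψ => ?_⟩
  · obtain ⟨f, rfl⟩ := hTs f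
    obtain ⟨g, hg⟩ := φ.2 f
    exact ⟨T g, fun x => by rw [hT, hT, hg, mul_left_comm]⟩
  · ext y
    obtain ⟨x, rfl⟩ := hb.2 y
    exact congrFun (congrArg Subtype.val h) x
  · obtain ⟨s, -, hs⟩ := Function.bijective_iff_has_inverse.1 hb
    have hs' : ∀ x, s (Set.rangeFactorization b x) = x := fun x => hb.1 (hs _)
    -- The preimage is `ψ ∘ s`: pull `ψ · T f` back through `T` and cancel `δ`.
    refine ⟨⟨fun y => (ψ : X → ℂ) (s y), fun f => ?_⟩, ?_⟩
    · obtain ⟨g, hg⟩ := ψ.2 (T f)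
      obtain ⟨g, rfl⟩ := hTs g
      refine ⟨g, fun y => ?_⟩
      obtain ⟨x, rfl⟩ := hb.2 y
      have h := hg x
      rw [hT, hT, mul_left_comm] at h
      beta_reduce
      rw [hs']
      exact mul_left_cancel₀ (hδ x) h
    · ext x
      exact congrArg (ψ : X → ℂ) (hs' x)

/-- Extension and restriction of multipliers pass between `V` and the ball; `φ ∘ b` sees only values
on `V`, and determines them. -/
theorem multSurjectiveEmbedding_iff_multBijectiveEmbedding :
    MultSurjectiveEmbedding H b ↔ MultBijectiveEmbedding H b := by
  constructor
  · rintro ⟨Φ, hΦ, hs⟩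
    choose E hE using fun φ : Mult (DruryArvesonOn (Set.range b)) => exists_mult_extension φ
    have hΦ' : IsMultComp (Set.rangeFactorization b) fun φ => Φ (E φ) := fun φ x =>
      (hΦ (E φ) x).trans (hE φ (Set.rangeFactorization b x))
    refine ⟨_, hΦ', fun φ ψ h => ?_, fun ψ => ?_⟩
    · ext y
      obtain ⟨x, rfl⟩ := Set.rangeFactorization_surjective y
      rw [← hΦ', ← hΦ']
      exact congrFun (congrArg Subtype.val h) x
    · obtain ⟨φ, rfl⟩ := hs ψ
      refine ⟨⟨_, restrict_mem_mult φ⟩, ?_⟩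
      ext x
      rw [hΦ', hΦ]
      rfl
  · rintro ⟨Φ, hΦ, hb⟩
    have hΦ' : IsMultComp b fun φ : Mult (DruryArveson d) =>
        Φ ⟨_, restrict_mem_mult (V := Set.range b) φ⟩ := fun φ x => hΦ _ x
    refine ⟨_, hΦ', fun ψ => ?_⟩
    obtain ⟨φ, rfl⟩ := hb.2 ψ
    obtain ⟨E, hE⟩ := exists_mult_extension φ
    refine ⟨E, ?_⟩
    ext x
    rw [hΦ', hΦ]
    exact hE (Set.rangeFactorization b x)

end Embeddings

end EmbRKHS

end

theorem proposition4p1 {X H : Type*} [NormedAddCommGroup H] [InnerProductSpace ℂ H]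
    [CompleteSpace H] [RKHS ℂ H X ℂ] (hsep : EmbRKHS.SeparatesPoints H)
    (d : ℕ∞) (b : X → EmbRKHS.Ball d) (δ : X → ℂ) (hδ : ∀ x, δ x ≠ 0) :
    -- (i) ⇔ (i') ⇔ (i'')
    (EmbRKHS.KernelFactorization H b δ ↔ EmbRKHS.CoisometricEmbedding H b δ) ∧
    (EmbRKHS.CoisometricEmbedding H b δ ↔ EmbRKHS.UnitaryEmbedding H b δ) ∧
    -- (i'') ⇒ (ii)
    (EmbRKHS.UnitaryEmbedding H b δ → EmbRKHS.SurjectiveEmbedding H b δ) ∧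
    -- (ii) ⇔ (ii')
    (EmbRKHS.SurjectiveEmbedding H b δ ↔ EmbRKHS.BijectiveEmbedding H b δ) ∧
    -- (ii') ⇒ (iii)
    (EmbRKHS.BijectiveEmbedding H b δ → EmbRKHS.MultSurjectiveEmbedding H b) ∧
    -- (iii) ⇔ (iii')
    (EmbRKHS.MultSurjectiveEmbedding H b ↔ EmbRKHS.MultBijectiveEmbedding H b) := by
  have h1 := EmbRKHS.kernelFactorization_iff_coisometricEmbedding (H := H) (b := b) (δ := δ)
  have h2 := EmbRKHS.kernelFactorization_iff_unitaryEmbedding (H := H) (b := b) hδ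
  have h3 := EmbRKHS.surjectiveEmbedding_iff_bijectiveEmbedding (H := H) (b := b) hδ
  have h4 := EmbRKHS.multSurjectiveEmbedding_iff_multBijectiveEmbedding (H := H) (b := b)
  exact ⟨h1, h1.symm.trans h2, fun h => h3.2 h.bijectiveEmbedding, h3,
    fun h => h4.2 (h.multBijectiveEmbedding hsep hδ), h4⟩
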